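/- All systems are finite-dimensional. For a state $\Omega^{AB}$ on $\mathcal H_A\otimes\mathcal H_B$ the conditional min-entropy is $H_{\min}(A|B)_\Omega=-\log_2\inf\{\mathrm{Tr}\,\tau^B:\ \tau^B\ge 0,\ \mathbb 1^A\otimes\tau^B\ge\Omega^{AB}\}$; for a tripartite state $\Omega^{ABC}$, $H_{\min}(A|B)_\Omega$ and $H_{\min}(A|C)_\Omega$ refer to the marginals $\Omega^{AB}=\mathrm{Tr}_C\,\Omega^{ABC}$ and $\Omega^{AC}=\mathrm{Tr}_B\,\Omega^{ABC}$. Let $\rho_1,\dots,\rho_n$ be density matrices on $\mathcal H_B$, let $\sigma_1,\dots,\sigma_n$ be density matrices on $\mathcal H_C$, let $(q_1,\dots,q_n)$ be a fixed probability distribution with $q_i>0$ for all $i$ (for example $q_i=1/n$), and let $A$ be a system with $d_A=d_C$. Then the following are equivalent: 1. there is a completely positive trace-preserving linear map $\mathcal E:\mathcal B(\mathcal H_B)\to\mathcal B(\mathcal H_C)$ with $\mathcal E(\rho_i)=\sigma_i$ for all $i=1,\dots,n$; 2. for all density matrices $\omega_1,\dots,\omega_n$ on $\mathcal H_A$, $$H_{\min}(A|B)_\Omega\le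 H_{\min}(A|C)_\Omega,\qquad\text{where}\quad \Omega^{ABC}=\sum_{i=1}^n q_i\,\omega_i\otimes\rho_i\otimes\sigma_i .$$ -/

import Mathlib

open scoped ComplexOrder MatrixOrder Kronecker CStarAlgebra Matrix.Norms.L2Operator

/- Finite-dimensional quantum systems. A system `X` is a finite type labelling an orthonormal basis
of its Hilbert space, so that the operators on it are the matrices `Matrix X X ℂ`, and the product
type `X × Y` labels the tensor product of two systems. Matrices carry the Loewner order:
`M ≤ N` means that `N - M` is positive semidefinite. -/

namespace QMaj

/-- Density matrices: positive semidefinite matrices of trace one. -/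
def IsDensityMatrix {X : Type*} [Fintype X] (ρ : Matrix X X ℂ) : Prop :=
  ρ.PosSemidef ∧ ρ.trace = 1

/-- A CPTP map from operators on `B` to operators on `C`: a completely positive linear map that
preserves the trace. -/
def IsCPTP {B C : Type*} [Fintype B] [DecidableEq B] [Fintype C] [DecidableEq C]
    (E : Matrix B B ℂ →ₗ[ℂ] Matrix C C ℂ) : Prop :=
  (∃ F : Matrix B B ℂ →CP Matrix C C ℂ, F.toLinearMap = E) ∧
    ∀ M : Matrix B B ℂ, (E M).trace = M.trace

/-- The marginal on `AB` of an operator on `ABC`: the partial trace over `C`. -/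
def marginalAB {A B C : Type*} [Fintype C]
    (M : Matrix ((A × B) × C) ((A × B) × C) ℂ) : Matrix (A × B) (A × B) ℂ :=
  Matrix.of fun x y => ∑ c : C, M (x, c) (y, c)

/-- The marginal on `AC` of an operator on `ABC`: the partial trace over `B`. -/
def marginalAC {A B C : Type*} [Fintype B]
    (M : Matrix ((A × B) × C) ((A × B) × C) ℂ) : Matrix (A × C) (A × C) ℂ :=
  Matrix.of fun x y => ∑ b : B, M ((x.1, b), x.2) ((y.1, b), y.2)

/-- The conditional min-entropy `H_min(A|B)` of an operator on `AB`: minus the logarithm to base 2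
of the infimum of `Tr τ` over all `τ ≥ 0` on `B` with `1 ⊗ τ ≥ Ω`. (If `Ω` is a state then the
infimum is over a non-empty set and is positive.) -/
noncomputable def condMinEntropy {A B : Type*} [Fintype A] [DecidableEq A] [Fintype B]
    (Ω : Matrix (A × B) (A × B) ℂ) : ℝ :=
  -Real.logb 2 (sInf {t : ℝ | ∃ τ : Matrix B B ℂ,
    0 ≤ τ ∧ Ω ≤ (1 : Matrix A A ℂ) ⊗ₖ τ ∧ τ.trace.re = t})

/-- The tripartite operator `∑ i, q i • (ω i ⊗ ρ i ⊗ σ i)` on `ABC`. -/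
def tripartite {n : ℕ} {A B C : Type*} (q : Fin n → ℝ) (ω : Fin n → Matrix A A ℂ)
    (ρ : Fin n → Matrix B B ℂ) (σ : Fin n → Matrix C C ℂ) :
    Matrix ((A × B) × C) ((A × B) × C) ℂ :=
  ∑ i, (q i : ℂ) • ((ω i ⊗ₖ ρ i) ⊗ₖ σ i)

end QMaj

/-! Up to `-logb 2`, the min-entropy is the value of a semidefinite program, so the claim compares
two infima of `Tr τ`. A channel `E` applied to the second factor of `1 ⊗ τ - Ω` keeps it positive
and keeps `Tr τ`, so every value feasible for `AB` is feasible for `AC` (`dominatingTraces_subset`).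

Conversely, a channel is a Choi matrix `X ≥ 0` subject to linear equations. The image of the
positive cone under these equations is closed and convex, so if no channel exists, Hahn-Banach gives
`Y` and Hermitian `H i` with `1 ⊗ Y ≥ ∑ H i ⊗ ρ i` but `Tr Y < ∑ pairing (H i) (σ i)`
(`exists_choi_or_witness`). Adding multiples of the identity and rescaling turns the `H i` into
states (`exists_density_witness`). The adjusted `Y` bounds the `AB` infimum from above; the
maximally entangled vector, available because `d_A = d_C`, bounds the `AC` infimum from below
(`pairing_le_of_mem_dominatingTraces`). The strict gap contradicts the entropy inequality. -/

namespace QMaj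

open Matrix

/-! ### Complete positivity and Choi matrices -/

/-- A matrix of matrices, read as a matrix on the product index type. -/
def flatten {k X : Type*} (M : CStarMatrix k k (Matrix X X ℂ)) : Matrix (k × X) (k × X) ℂ :=
  Matrix.of fun p q => M p.1 q.1 p.2 q.2

theorem flatten_star_mul_self {k X : Type*} [Fintype k] [Fintype X] [DecidableEq X]
    (N : CStarMatrix k k (Matrix X X ℂ)) :
    flatten (star N * N) = (flatten N)ᴴ * flatten N := by
  ext p q
  simp only [flatten, of_apply, CStarMatrix.mul_apply, CStarMatrix.star_apply, Matrix.mul_apply,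
    Matrix.sum_apply, conjTranspose_apply, star_eq_conjTranspose, Fintype.sum_prod_type]

theorem flatten_injective {k X : Type*} :
    Function.Injective (flatten : CStarMatrix k k (Matrix X X ℂ) → _) := by
  intro M N h
  ext i j a b
  exact congrFun (congrFun h (i, a)) (j, b)

theorem posSemidef_iff_eq_conjTranspose_mul_self {X : Type*} [Fintype X] [DecidableEq X]
    {M : Matrix X X ℂ} : M.PosSemidef ↔ ∃ S : Matrix X X ℂ, M = Sᴴ * S := by
  rw [← nonneg_iff_posSemidef, CStarAlgebra.nonneg_iff_eq_star_mul_self]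
  rfl

theorem nonneg_iff_exists_star_mul_self {A : Type*} [NonUnitalCStarAlgebra A] [PartialOrder A]
    [StarOrderedRing A] {a : A} : 0 ≤ a ↔ ∃ b, a = star b * b :=
  CStarAlgebra.nonneg_iff_eq_star_mul_self

/-- On both sides the positive elements are exactly the `star N * N`, and flattening respects this
form. -/
theorem cstarMatrix_nonneg_iff {k X : Type*} [Fintype k] [Fintype X] [DecidableEq X]
    {M : CStarMatrix k k (Matrix X X ℂ)} : 0 ≤ M ↔ (flatten M).PosSemidef := by
  classical
  rw [nonneg_iff_exists_star_mul_self, posSemidef_iff_eq_conjTranspose_mul_self]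
  constructor
  · rintro ⟨N, rfl⟩
    exact ⟨flatten N, flatten_star_mul_self N⟩
  · rintro ⟨S, hS⟩
    let N : CStarMatrix k k (Matrix X X ℂ) :=
      CStarMatrix.ofMatrix fun i j => Matrix.of fun a b => S (i, a) (j, b)
    refine ⟨N, flatten_injective ?_⟩
    rw [hS, flatten_star_mul_self]
    rfl

/-- Complete positivity: applying `E` to the second factor preserves positivity. -/
theorem IsCPTP.posSemidef_block {A B C : Type*} [Fintype A]
    [Fintype B] [DecidableEq B] [Fintype C] [DecidableEq C]
    {E : Matrix B B ℂ →ₗ[ℂ] Matrix C C ℂ} (hE : IsCPTP E)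
    {Ω : Matrix (A × B) (A × B) ℂ} (hΩ : Ω.PosSemidef) :
    (Matrix.of fun p q : A × C =>
      E (Matrix.of fun b b' => Ω (p.1, b) (q.1, b')) p.2 q.2).PosSemidef := by
  obtain ⟨⟨F, rfl⟩, -⟩ := hE
  let M : CStarMatrix A A (Matrix B B ℂ) :=
    CStarMatrix.ofMatrix fun i j => Matrix.of fun a b => Ω (i, a) (j, b)
  have h := F.map_cstarMatrix_nonneg M (cstarMatrix_nonneg_iff.2 hΩ)
  exact cstarMatrix_nonneg_iff.1 h

/-- The linear map with Choi matrix `X`. -/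
def choiMap {B C : Type*} [Fintype B] (X : Matrix (C × B) (C × B) ℂ) :
    Matrix B B ℂ →ₗ[ℂ] Matrix C C ℂ where
  toFun M := Matrix.of fun c c' => ∑ b, ∑ b', X (c, b) (c', b') * M b b'
  map_add' M N := by
    ext; simp [mul_add, Finset.sum_add_distrib]
  map_smul' r M := by
    ext; simp [Finset.mul_sum, mul_left_comm]

theorem choiMap_apply {B C : Type*} [Fintype B] (X : Matrix (C × B) (C × B) ℂ)
    (M : Matrix B B ℂ) (c c' : C) :
    choiMap X M c c' = ∑ b, ∑ b', X (c, b) (c', b') * M b b' := rfl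

theorem isCPTP_choiMap {B C : Type*} [Fintype B] [DecidableEq B] [Fintype C] [DecidableEq C]
    {X : Matrix (C × B) (C × B) ℂ} (hX : X.PosSemidef)
    (htr : ∀ b b', ∑ c, X (c, b) (c, b') = (1 : Matrix B B ℂ) b b') : IsCPTP (choiMap X) := by
  refine ⟨⟨⟨choiMap X, ?_⟩, rfl⟩, ?_⟩
  · intro k M hM
    rw [cstarMatrix_nonneg_iff] at hM ⊢
    obtain ⟨S, rfl⟩ := posSemidef_iff_eq_conjTranspose_mul_self.1 hX
    -- Kraus operators: the conjugated rows of `S`, reshaped as `C × B` matrices and tensored with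
    -- the identity on `Fin k`.
    let V : C × B → Matrix (Fin k × C) (Fin k × B) ℂ := fun l => Matrix.of fun p r =>
      if p.1 = r.1 then star (S l (p.2, r.2)) else 0
    have key : flatten (M.map (choiMap (Sᴴ * S))) = ∑ l, V l * flatten M * (V l)ᴴ := by
      ext p q
      simp only [flatten, of_apply, CStarMatrix.map_apply, choiMap_apply, Matrix.sum_apply,
        Matrix.mul_apply, conjTranspose_apply, V, apply_ite star, star_star, star_zero,
        Finset.sum_mul, ite_mul, mul_ite, zero_mul, mul_zero]
      simp only [Fintype.sum_prod_type (α₁ := Fin k)]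
      conv_rhs =>
        enter [2, l]
        rw [Finset.sum_eq_single q.1 (by
          intro i _ hi; simp [hi.symm]) (by simp)]
        simp only [if_true]
        enter [2, b']
        rw [Finset.sum_eq_single p.1 (by
          intro i _ hi; simp [hi.symm]) (by simp)]
        simp only [if_true]
      rw [Finset.sum_comm]
      conv_lhs =>
        enter [2, b']
        rw [Finset.sum_comm]
      rw [Finset.sum_comm]
      refine Finset.sum_congr rfl fun l _ => Finset.sum_congr rfl fun b' _ =>
        Finset.sum_congr rfl fun b _ => ?_
      ring
    rw [show flatten (M.map ((choiMap (Sᴴ * S)))) = _ from key]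
    exact posSemidef_sum _ fun l _ => hM.mul_mul_conjTranspose_same _
  · intro M
    simp only [Matrix.trace, diag_apply, choiMap_apply]
    rw [Finset.sum_comm]
    refine Finset.sum_congr rfl fun b _ => ?_
    rw [Finset.sum_comm]
    simp only [← Finset.sum_mul, htr, Matrix.one_apply, ite_mul, one_mul, zero_mul]
    simp

/-! ### Trace bounds and compactness -/

theorem PosSemidef.le_trace {X : Type*} [Fintype X] [DecidableEq X] {M : Matrix X X ℂ}
    (hM : M.PosSemidef) : M ≤ algebraMap ℝ (Matrix X X ℂ) M.trace.re := by
  have hsa : IsSelfAdjoint M := hM.isHermitian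
  rw [le_algebraMap_iff_spectrum_le (R := ℝ) (a := M)]
  intro x hx
  rw [hM.isHermitian.spectrum_real_eq_range_eigenvalues] at hx
  obtain ⟨i, rfl⟩ := hx
  rw [hM.isHermitian.trace_eq_sum_eigenvalues]
  simp only [Complex.re_sum]
  exact Finset.single_le_sum (f := fun i => hM.isHermitian.eigenvalues i)
    (fun j _ => hM.eigenvalues_nonneg j) (Finset.mem_univ i)

theorem PosSemidef.norm_le_trace {X : Type*} [Fintype X] [DecidableEq X] {M : Matrix X X ℂ}
    (hM : M.PosSemidef) : ‖M‖ ≤ M.trace.re :=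
  (CStarAlgebra.norm_le_iff_le_algebraMap M (Complex.le_def.1 hM.trace_nonneg).1
    (nonneg_iff_posSemidef.2 hM)).2 (PosSemidef.le_trace hM)

theorem isCompact_posSemidef_trace_le (X : Type*) [Fintype X] [DecidableEq X] (r : ℝ) :
    IsCompact {M : Matrix X X ℂ | M.PosSemidef ∧ M.trace.re ≤ r} := by
  have : ProperSpace (Matrix X X ℂ) := FiniteDimensional.proper ℂ _
  rw [Set.ofPred_and]
  refine (isCompact_closedBall (0 : Matrix X X ℂ) r).of_isClosed_subset ?_ ?_
  · refine IsClosed.inter ?_ ?_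
    · have := CStarAlgebra.isClosed_nonneg (A := Matrix X X ℂ)
      simpa only [nonneg_iff_posSemidef] using this
    · refine isClosed_le ?_ continuous_const
      exact Complex.continuous_re.comp
        (LinearMap.continuous_of_finiteDimensional (Matrix.traceLinearMap X ℂ ℂ))
  · rintro M ⟨hM, hr⟩
    rw [mem_closedBall_zero_iff]
    exact (PosSemidef.norm_le_trace hM).trans hr

/-! ### Bilinear pairing -/

/-- The bilinear pairing `∑ c c', M c c' * N c c'`. -/
def pairing {X : Type*} [Fintype X] (M N : Matrix X X ℂ) : ℂ := ∑ a, ∑ b, M a b * N a b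

theorem pairing_add_left {X : Type*} [Fintype X] (M M' N : Matrix X X ℂ) :
    pairing (M + M') N = pairing M N + pairing M' N := by
  simp [pairing, add_mul, Finset.sum_add_distrib]

theorem pairing_smul_left {X : Type*} [Fintype X] (r : ℂ) (M N : Matrix X X ℂ) :
    pairing (r • M) N = r * pairing M N := by
  simp [pairing, Finset.mul_sum, mul_assoc]

theorem pairing_one_left {X : Type*} [Fintype X] [DecidableEq X] (N : Matrix X X ℂ) :
    pairing 1 N = N.trace := by
  simp [pairing, Matrix.one_apply, Matrix.trace]

theorem pairing_conjTranspose_left {X : Type*} [Fintype X] (M : Matrix X X ℂ)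
    {N : Matrix X X ℂ} (hN : N.IsHermitian) : pairing Mᴴ N = star (pairing M N) := by
  simp only [pairing, star_sum, star_mul', conjTranspose_apply]
  rw [Finset.sum_comm]
  refine Finset.sum_congr rfl fun a _ => Finset.sum_congr rfl fun b _ => ?_
  rw [hN.apply]

theorem pairing_submatrix {X Y : Type*} [Fintype X] [Fintype Y] (e : X ≃ Y)
    (M N : Matrix Y Y ℂ) : pairing (M.submatrix e e) (N.submatrix e e) = pairing M N := by
  simp only [pairing, submatrix_apply]
  rw [e.sum_comp (fun a => ∑ b, M a (e b) * N a (e b))]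
  exact Finset.sum_congr rfl fun a _ => e.sum_comp (fun b => M a b * N a b)

theorem linearMap_eq_pairing {X : Type*} [Fintype X] [DecidableEq X]
    (g : Matrix X X ℂ →ₗ[ℂ] ℂ) : ∃ G : Matrix X X ℂ, ∀ M, g M = pairing G M := by
  refine ⟨Matrix.of fun a b => g (Matrix.single a b 1), fun M => ?_⟩
  conv_lhs => rw [matrix_eq_sum_single M]
  simp only [map_sum, pairing, of_apply]
  refine Finset.sum_congr rfl fun a _ => Finset.sum_congr rfl fun b _ => ?_
  rw [← mul_one (M a b), ← smul_eq_mul, ← Matrix.smul_single, map_smul, smul_eq_mul, smul_eq_mul,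
    mul_one, mul_comm]

/-- Test on rank-one matrices. Only real parts are controlled, hence the symmetrization of `W`. -/
theorem posSemidef_add_conjTranspose {X : Type*} [Fintype X] {W : Matrix X X ℂ}
    (h : ∀ M : Matrix X X ℂ, M.PosSemidef → 0 ≤ (pairing W M).re) : (W + Wᴴ).PosSemidef := by
  refine PosSemidef.of_dotProduct_mulVec_nonneg (isHermitian_add_transpose_self W) fun x => ?_
  have key : star x ⬝ᵥ W *ᵥ x = pairing W (vecMulVec (star x) x) := by
    simp only [dotProduct, mulVec, pairing, vecMulVec_apply, Finset.mul_sum]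
    exact Finset.sum_congr rfl fun a _ => Finset.sum_congr rfl fun b _ => by ring
  have key' : star x ⬝ᵥ Wᴴ *ᵥ x = star (pairing W (vecMulVec (star x) x)) := by
    rw [← key, star_dotProduct, star_mulVec, conjTranspose_conjTranspose, ← dotProduct_mulVec]
  rw [add_mulVec, dotProduct_add, key, key']
  have := h _ (posSemidef_vecMulVec_star_self x)
  rw [Complex.le_def]
  constructor
  · simp; linarith
  · simp

/-! ### Separation from the cone of Choi data -/

/-- The partial trace over the first factor, together with the images of the `ρ i` under the map
with the given Choi matrix. -/
def choiData {n : ℕ} {B C : Type*} [Fintype B] [Fintype C] (ρ : Fin n → Matrix B B ℂ) :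
    Matrix (C × B) (C × B) ℂ →ₗ[ℂ] Matrix B B ℂ × (Fin n → Matrix C C ℂ) where
  toFun X := (Matrix.of fun b b' => ∑ c, X (c, b) (c, b'), fun i => choiMap X (ρ i))
  map_add' X Y := by
    ext <;> simp [choiMap_apply, add_mul, Finset.sum_add_distrib]
  map_smul' r X := by
    ext <;> simp [choiMap_apply, Finset.mul_sum, mul_assoc]

/-- Computes the adjoint of `choiData` for the pairing; this is where the dual constraint comes
from. -/
theorem pairing_choiData {n : ℕ} {B C : Type*} [Fintype B] [Fintype C] [DecidableEq C]
    (ρ : Fin n → Matrix B B ℂ) (X : Matrix (C × B) (C × B) ℂ) (Y : Matrix B B ℂ)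
    (H : Fin n → Matrix C C ℂ) :
    pairing Y (choiData ρ X).1 + ∑ i, pairing (H i) ((choiData ρ X).2 i) =
      pairing ((1 : Matrix C C ℂ) ⊗ₖ Y + ∑ i, H i ⊗ₖ ρ i) X := by
  rw [pairing_add_left]
  congr 1
  · simp only [pairing, choiData, LinearMap.coe_mk, AddHom.coe_mk, of_apply, kronecker_apply,
      Fintype.sum_prod_type, Matrix.one_apply, ite_mul, one_mul, zero_mul, Finset.mul_sum]
    rw [Finset.sum_congr rfl fun b _ => Finset.sum_comm]
    rw [Finset.sum_comm]
    refine Finset.sum_congr rfl fun c _ => Finset.sum_congr rfl fun b _ => ?_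
    rw [Finset.sum_comm]
    simp
  · have : pairing (∑ i, H i ⊗ₖ ρ i) X = ∑ i, pairing (H i ⊗ₖ ρ i) X := by
      simp only [pairing, Matrix.sum_apply, Finset.sum_mul]
      rw [Finset.sum_congr rfl fun p _ => Finset.sum_comm, Finset.sum_comm]
    rw [this]
    refine Finset.sum_congr rfl fun i _ => ?_
    simp only [pairing, choiData, LinearMap.coe_mk, AddHom.coe_mk, kronecker_apply,
      Fintype.sum_prod_type, choiMap_apply, Finset.mul_sum]
    refine Finset.sum_congr rfl fun c _ => ?_
    rw [Finset.sum_comm]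
    refine Finset.sum_congr rfl fun b _ => ?_
    refine Finset.sum_congr rfl fun c' _ => ?_
    refine Finset.sum_congr rfl fun b' _ => ?_
    ring

theorem trace_choiData {n : ℕ} {B C : Type*} [Fintype B] [Fintype C]
    (ρ : Fin n → Matrix B B ℂ) (X : Matrix (C × B) (C × B) ℂ) :
    (choiData ρ X).1.trace = X.trace := by
  simp only [Matrix.trace, diag_apply, choiData, LinearMap.coe_mk, AddHom.coe_mk, of_apply,
    Fintype.sum_prod_type]
  exact Finset.sum_comm

/-- The image of the positive semidefinite cone under `choiData` is closed. -/
theorem isClosed_choiData_image {n : ℕ} {B C : Type*} [Fintype B] [DecidableEq B] [Fintype C]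
    [DecidableEq C] (ρ : Fin n → Matrix B B ℂ) :
    IsClosed (choiData (C := C) ρ '' {X | X.PosSemidef}) := by
  refine isClosed_of_closure_subset fun v hv => ?_
  -- Near `v` the trace of a preimage is bounded, because `choiData` remembers it, so only a compact
  -- part of the cone matters.
  let U : Set (Matrix B B ℂ × (Fin n → Matrix C C ℂ)) :=
    {w | w.1.trace.re < v.1.trace.re + 1}
  have hU : IsOpen U := by
    refine isOpen_lt ?_ continuous_const
    exact Complex.continuous_re.comp ((LinearMap.continuous_of_finiteDimensional
      (Matrix.traceLinearMap B ℂ ℂ)).comp continuous_fst)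
  have hvU : v ∈ U := by simp [U]
  have hcpt := ((isCompact_posSemidef_trace_le (C × B) (v.1.trace.re + 1)).image
    (LinearMap.continuous_of_finiteDimensional (choiData (C := C) ρ))).isClosed
  have hsub : U ∩ choiData (C := C) ρ '' {X | X.PosSemidef} ⊆
      choiData (C := C) ρ '' {X | X.PosSemidef ∧ X.trace.re ≤ v.1.trace.re + 1} := by
    rintro _ ⟨hw, X, hX, rfl⟩
    refine ⟨X, ⟨hX, ?_⟩, rfl⟩
    rw [← trace_choiData ρ X]
    exact le_of_lt hw
  have h1 := hcpt.closure_subset_iff.2 hsub (hU.inter_closure ⟨hvU, hv⟩)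
  exact Set.image_mono (fun X hX => hX.1) h1

/-- Either some quantum channel maps each `ρ i` to `σ i`, or a dual witness forbids it. -/
theorem exists_choi_or_witness {n : ℕ} {B C : Type*} [Fintype B] [DecidableEq B] [Fintype C]
    [DecidableEq C] (ρ : Fin n → Matrix B B ℂ) (hρ : ∀ i, (ρ i).IsHermitian)
    (σ : Fin n → Matrix C C ℂ) (hσ : ∀ i, (σ i).IsHermitian) :
    (∃ E : Matrix B B ℂ →ₗ[ℂ] Matrix C C ℂ, IsCPTP E ∧ ∀ i, E (ρ i) = σ i) ∨
    ∃ (Y : Matrix B B ℂ) (H : Fin n → Matrix C C ℂ), (∀ i, (H i).IsHermitian) ∧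
      ((1 : Matrix C C ℂ) ⊗ₖ Y - ∑ i, H i ⊗ₖ ρ i).PosSemidef ∧
      Y.trace.re < ∑ i, (pairing (H i) (σ i)).re := by
  by_cases hmem : ((1 : Matrix B B ℂ), σ) ∈ choiData (C := C) ρ '' {X | X.PosSemidef}
  · left
    obtain ⟨X, hX, h⟩ := hmem
    have h1 := congrArg Prod.fst h
    have h2 := congrArg Prod.snd h
    exact ⟨choiMap X, isCPTP_choiMap hX fun b b' => congrFun (congrFun h1 b) b',
      fun i => congrFun h2 i⟩
  right
  have hconv : Convex ℝ (choiData (C := C) ρ '' {X | X.PosSemidef}) := by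
    refine Convex.is_linear_image ?_ ⟨map_add _, fun r X => ?_⟩
    · intro X hX Y hY a b ha hb _
      exact (PosSemidef.smul hX ha).add (PosSemidef.smul hY hb)
    · exact (choiData (C := C) ρ).map_smul_of_tower r X
  obtain ⟨f, u, hlt, hgt⟩ := RCLike.geometric_hahn_banach_closed_point (𝕜 := ℂ) hconv
    (isClosed_choiData_image ρ) hmem
  obtain ⟨Y, hY⟩ := linearMap_eq_pairing
    (f.toLinearMap.comp (LinearMap.inl ℂ (Matrix B B ℂ) (Fin n → Matrix C C ℂ)))
  choose H hH using fun i => linearMap_eq_pairing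
    (f.toLinearMap.comp ((LinearMap.inr ℂ (Matrix B B ℂ) (Fin n → Matrix C C ℂ)).comp
      (LinearMap.single ℂ (fun _ : Fin n => Matrix C C ℂ) i)))
  have hf : ∀ T Z, f (T, Z) = pairing Y T + ∑ i, pairing (H i) (Z i) := by
    intro T Z
    rw [← hY, Finset.sum_congr rfl fun i _ => (hH i (Z i)).symm]
    simp only [LinearMap.comp_apply, ← map_sum]
    rw [show ∑ i, (LinearMap.single ℂ (fun _ : Fin n => Matrix C C ℂ) i) (Z i) = Z from
      Finset.univ_sum_single Z, ← map_add]
    simp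
  have hfX : ∀ X, f (choiData ρ X) = pairing ((1 : Matrix C C ℂ) ⊗ₖ Y + ∑ i, H i ⊗ₖ ρ i) X :=
    fun X => by rw [← pairing_choiData]; exact hf _ _
  have hu : 0 < u := by
    have := hlt _ ⟨0, PosSemidef.zero, rfl⟩
    simpa using this
  -- On a cone, a functional bounded above is nonpositive: otherwise rescaling `X` makes its real
  -- part equal to `u`.
  have hneg : ∀ X : Matrix (C × B) (C × B) ℂ, X.PosSemidef → (f (choiData ρ X)).re ≤ 0 := by
    intro X hX
    by_contra! hpos
    have hr : 0 ≤ u / (f (choiData ρ X)).re := (div_pos hu hpos).le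
    have := hlt _ ⟨_, PosSemidef.smul hX hr, rfl⟩
    rw [(choiData (C := C) ρ).map_smul_of_tower, f.map_smul_of_tower] at this
    simp [div_mul_cancel₀ _ hpos.ne'] at this
  refine ⟨-(Y + Yᴴ), fun i => H i + (H i)ᴴ, fun i => isHermitian_add_transpose_self _, ?_, ?_⟩
  · have hW := posSemidef_add_conjTranspose
      (W := -((1 : Matrix C C ℂ) ⊗ₖ Y + ∑ i, H i ⊗ₖ ρ i)) (fun X hX => by
        have := hneg X hX
        rw [hfX] at this
        rw [← neg_one_smul ℂ, pairing_smul_left]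
        simpa using this)
    convert hW using 1
    simp only [conjTranspose_neg, conjTranspose_add, conjTranspose_sum, conjTranspose_kronecker,
      conjTranspose_one, (hρ _).eq, add_kronecker, Finset.sum_add_distrib]
    rw [← neg_one_smul ℂ (Y + Yᴴ), kronecker_smul, kronecker_add, neg_one_smul]
    abel
  · have h := hu.trans hgt
    rw [hf] at h
    simp only [pairing_add_left, pairing_conjTranspose_left _ (hσ _)]
    have hY1 : pairing Y 1 = Y.trace := by simp [pairing, Matrix.one_apply, Matrix.trace]
    rw [hY1] at h
    simp only [trace_neg, trace_add, trace_conjTranspose]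
    simp at h ⊢
    rw [Finset.sum_add_distrib]
    linarith

/-! ### Min-entropy as an infimum of traces -/

/-- The traces of the operators `τ ≥ 0` with `1 ⊗ τ ≥ Ω`. -/
def dominatingTraces {A B : Type*} [DecidableEq A] [Fintype B]
    (Ω : Matrix (A × B) (A × B) ℂ) : Set ℝ :=
  {t : ℝ | ∃ τ : Matrix B B ℂ, 0 ≤ τ ∧ Ω ≤ (1 : Matrix A A ℂ) ⊗ₖ τ ∧ τ.trace.re = t}

theorem condMinEntropy_eq {A B : Type*} [Fintype A] [DecidableEq A] [Fintype B]
    (Ω : Matrix (A × B) (A × B) ℂ) :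
    condMinEntropy Ω = -Real.logb 2 (sInf (dominatingTraces Ω)) := rfl

/-- Take traces in `Ω ≤ 1 ⊗ τ`. This keeps the infimum away from zero, so the logarithm is strictly
monotone there. -/
theorem one_le_card_mul_of_mem_dominatingTraces {A B : Type*} [Fintype A] [DecidableEq A]
    [Fintype B] {Ω : Matrix (A × B) (A × B) ℂ} (hΩ : Ω.trace = 1) {t : ℝ}
    (ht : t ∈ dominatingTraces Ω) : 1 ≤ Fintype.card A * t := by
  obtain ⟨τ, -, h, rfl⟩ := ht
  have := (Complex.le_def.1 (Matrix.le_iff.1 h).trace_nonneg).1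
  rw [trace_sub, hΩ, trace_kronecker, trace_one] at this
  simpa using this

theorem bddBelow_dominatingTraces {A B : Type*} [DecidableEq A] [Fintype B]
    (Ω : Matrix (A × B) (A × B) ℂ) : BddBelow (dominatingTraces Ω) := by
  refine ⟨0, ?_⟩
  rintro t ⟨τ, hτ, -, rfl⟩
  exact (Complex.le_def.1 (nonneg_iff_posSemidef.1 hτ).trace_nonneg).1

theorem dominatingTraces_nonempty {A B : Type*} [Fintype A] [DecidableEq A] [Fintype B]
    {Ω : Matrix (A × B) (A × B) ℂ} (hΩ : Ω.PosSemidef) : (dominatingTraces Ω).Nonempty := by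
  classical
  refine ⟨_, Ω.trace.re • (1 : Matrix B B ℂ), ?_, ?_, rfl⟩
  · exact nonneg_iff_posSemidef.2
      (PosSemidef.one.smul (Complex.le_def.1 hΩ.trace_nonneg).1)
  · have := PosSemidef.le_trace hΩ
    rwa [Algebra.algebraMap_eq_smul_one, ← one_kronecker_one, ← kronecker_smul] at this

theorem sInf_dominatingTraces_pos {A B : Type*} [Fintype A] [DecidableEq A] [Fintype B]
    {Ω : Matrix (A × B) (A × B) ℂ} (hΩ : IsDensityMatrix Ω) :
    0 < sInf (dominatingTraces Ω) := by
  have hne := dominatingTraces_nonempty hΩ.1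
  obtain ⟨t, ht⟩ := hne
  have hA : (0 : ℝ) < Fintype.card A := by
    rcases (Nat.cast_nonneg (α := ℝ) (Fintype.card A)).eq_or_lt with h | h
    · have := one_le_card_mul_of_mem_dominatingTraces hΩ.2 ht
      rw [← h] at this
      linarith
    · exact h
  refine lt_of_lt_of_le (one_div_pos.2 hA) (le_csInf ⟨t, ht⟩ fun s hs => ?_)
  rw [div_le_iff₀' hA]
  exact one_le_card_mul_of_mem_dominatingTraces hΩ.2 hs

theorem condMinEntropy_le_iff {A B C : Type*} [Fintype A] [DecidableEq A] [Fintype B] [Fintype C]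
    {Ω : Matrix (A × B) (A × B) ℂ} {Θ : Matrix (A × C) (A × C) ℂ} (hΩ : IsDensityMatrix Ω)
    (hΘ : IsDensityMatrix Θ) : condMinEntropy Ω ≤ condMinEntropy Θ ↔
      sInf (dominatingTraces Θ) ≤ sInf (dominatingTraces Ω) := by
  rw [condMinEntropy_eq, condMinEntropy_eq, neg_le_neg_iff,
    Real.logb_le_logb one_lt_two (sInf_dominatingTraces_pos hΘ) (sInf_dominatingTraces_pos hΩ)]

/-- The bipartite operator `∑ i, q i • (ω i ⊗ ρ i)`. -/
def bipartite {n : ℕ} {A B : Type*} (q : Fin n → ℝ) (ω : Fin n → Matrix A A ℂ)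
    (ρ : Fin n → Matrix B B ℂ) : Matrix (A × B) (A × B) ℂ :=
  ∑ i, (q i : ℂ) • (ω i ⊗ₖ ρ i)

theorem isDensityMatrix_bipartite {n : ℕ} {A B : Type*} [Fintype A] [Fintype B] {q : Fin n → ℝ}
    (hq : ∀ i, 0 < q i) (hq1 : ∑ i, q i = 1) {ω : Fin n → Matrix A A ℂ}
    (hω : ∀ i, IsDensityMatrix (ω i)) {ρ : Fin n → Matrix B B ℂ}
    (hρ : ∀ i, IsDensityMatrix (ρ i)) : IsDensityMatrix (bipartite q ω ρ) := by
  constructor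
  · exact posSemidef_sum _ fun i _ => ((hω i).1.kronecker (hρ i).1).smul
      (Complex.zero_le_real.2 (hq i).le)
  · simp only [bipartite, trace_sum, trace_smul, trace_kronecker, (hω _).2, (hρ _).2, mul_one,
      smul_eq_mul]
    exact_mod_cast hq1

theorem marginalAB_tripartite {n : ℕ} {A B C : Type*} [Fintype C] (q : Fin n → ℝ)
    (ω : Fin n → Matrix A A ℂ) (ρ : Fin n → Matrix B B ℂ) {σ : Fin n → Matrix C C ℂ}
    (hσ : ∀ i, (σ i).trace = 1) : marginalAB (tripartite q ω ρ σ) = bipartite q ω ρ := by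
  ext x y
  simp only [marginalAB, tripartite, bipartite, of_apply, Matrix.sum_apply, Matrix.smul_apply,
    kronecker_apply, smul_eq_mul]
  rw [Finset.sum_comm]
  refine Finset.sum_congr rfl fun i _ => ?_
  rw [← Finset.mul_sum, ← Finset.mul_sum]
  have := hσ i
  simp only [Matrix.trace, diag_apply] at this
  rw [this, mul_one]

theorem marginalAC_tripartite {n : ℕ} {A B C : Type*} [Fintype B] (q : Fin n → ℝ)
    (ω : Fin n → Matrix A A ℂ) {ρ : Fin n → Matrix B B ℂ} (σ : Fin n → Matrix C C ℂ)
    (hρ : ∀ i, (ρ i).trace = 1) : marginalAC (tripartite q ω ρ σ) = bipartite q ω σ := by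
  ext x y
  simp only [marginalAC, tripartite, bipartite, of_apply, Matrix.sum_apply, Matrix.smul_apply,
    kronecker_apply, smul_eq_mul]
  rw [Finset.sum_comm]
  refine Finset.sum_congr rfl fun i _ => ?_
  rw [← Finset.mul_sum, ← Finset.sum_mul, ← Finset.mul_sum]
  have := hρ i
  simp only [Matrix.trace, diag_apply] at this
  rw [this, mul_one, kronecker_apply]

/-! ### From a channel to the entropy inequality -/

/-- Data processing: a channel on the second system maps dominating operators to dominating
operators. -/
theorem dominatingTraces_subset {n : ℕ} {A B C : Type*} [Fintype A] [DecidableEq A]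
    [Fintype B] [DecidableEq B] [Fintype C] [DecidableEq C] (q : Fin n → ℝ)
    (ω : Fin n → Matrix A A ℂ) {ρ : Fin n → Matrix B B ℂ} {σ : Fin n → Matrix C C ℂ}
    {E : Matrix B B ℂ →ₗ[ℂ] Matrix C C ℂ} (hE : IsCPTP E) (hEρ : ∀ i, E (ρ i) = σ i) :
    dominatingTraces (bipartite q ω ρ) ⊆ dominatingTraces (bipartite q ω σ) := by
  rintro t ⟨τ, hτ, h, rfl⟩
  refine ⟨E τ, ?_, ?_, by rw [hE.2]⟩
  -- Plain positivity of `E` is the case of a trivial reference system.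
  · have := hE.posSemidef_block (A := Unit)
      (Ω := τ.submatrix Prod.snd Prod.snd) ((nonneg_iff_posSemidef.1 hτ).submatrix _)
    exact nonneg_iff_posSemidef.2 (this.submatrix fun c => ((), c))
  · rw [Matrix.le_iff]
    have h1 := hE.posSemidef_block (Matrix.le_iff.1 h)
    have h2 : (Matrix.of fun p r : A × C => E (Matrix.of fun b b' =>
        ((1 : Matrix A A ℂ) ⊗ₖ τ - bipartite q ω ρ) (p.1, b) (r.1, b')) p.2 r.2) =
        (1 : Matrix A A ℂ) ⊗ₖ E τ - bipartite q ω σ := by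
      ext p r
      have hs : (Matrix.of fun b b' =>
          ((1 : Matrix A A ℂ) ⊗ₖ τ - bipartite q ω ρ) (p.1, b) (r.1, b')) =
          (1 : Matrix A A ℂ) p.1 r.1 • τ - ∑ i, (q i : ℂ) • (ω i p.1 r.1 • ρ i) := by
        ext b b'
        simp [bipartite, Matrix.sum_apply]
      simp only [of_apply, hs, map_sub, map_smul, map_sum, hEρ]
      simp [bipartite, Matrix.sum_apply]
    rwa [h2] at h1

/-! ### From the entropy inequality to a channel -/

/-- Weak duality, tested on the unnormalized maximally entangled vector. -/
theorem pairing_le_of_mem_dominatingTraces {n : ℕ} {A C : Type*} [DecidableEq A]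
    [Fintype A] [Fintype C] (e : A ≃ C) (q : Fin n → ℝ)
    (H : Fin n → Matrix C C ℂ) (σ : Fin n → Matrix C C ℂ) {t : ℝ}
    (ht : t ∈ dominatingTraces (bipartite q (fun i => (H i).submatrix e e) σ)) :
    ∑ i, q i * (pairing (H i) (σ i)).re ≤ t := by
  classical
  obtain ⟨τ, -, h, rfl⟩ := ht
  have key : ∀ M : Matrix (A × C) (A × C) ℂ,
      star (fun p : A × C => if e p.1 = p.2 then (1 : ℂ) else 0) ⬝ᵥ
        M *ᵥ (fun p : A × C => if e p.1 = p.2 then (1 : ℂ) else 0) =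
      ∑ a, ∑ a', M (a, e a) (a', e a') := by
    intro M
    simp [dotProduct, mulVec, Fintype.sum_prod_type, apply_ite star]
  have h1 := (Complex.le_def.1 ((Matrix.le_iff.1 h).dotProduct_mulVec_nonneg
    (fun p : A × C => if e p.1 = p.2 then (1 : ℂ) else 0))).1
  rw [key] at h1
  have h2 : ∑ a, ∑ a', ((1 : Matrix A A ℂ) ⊗ₖ τ - bipartite q (fun i => (H i).submatrix e e) σ)
      (a, e a) (a', e a') = τ.trace - ∑ i, (q i : ℂ) * pairing (H i) (σ i) := by
    simp only [Matrix.sub_apply, Finset.sum_sub_distrib]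
    congr 1
    · simp only [kronecker_apply, Matrix.one_apply, ite_mul, one_mul, zero_mul,
        Finset.sum_ite_eq, Finset.mem_univ, if_true]
      exact e.sum_comp fun c => τ c c
    · simp only [bipartite, Matrix.sum_apply, Matrix.smul_apply, kronecker_apply, smul_eq_mul]
      rw [Finset.sum_congr rfl fun a _ => Finset.sum_comm, Finset.sum_comm]
      refine Finset.sum_congr rfl fun i _ => ?_
      rw [← pairing_submatrix e, pairing]
      simp only [Finset.mul_sum]
      rfl
  rw [h2] at h1
  simpa using h1

/-- A dual witness may be taken to consist of density matrices. -/
theorem exists_density_witness {n : ℕ} {B C : Type*} [Fintype B] [Fintype C] [DecidableEq C]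
    [Nonempty C] {q : Fin n → ℝ} (hq : ∀ i, 0 < q i) {ρ : Fin n → Matrix B B ℂ}
    (hρ : ∀ i, IsDensityMatrix (ρ i)) {σ : Fin n → Matrix C C ℂ}
    (hσ : ∀ i, IsDensityMatrix (σ i)) {Y : Matrix B B ℂ} {H : Fin n → Matrix C C ℂ}
    (hH : ∀ i, (H i).IsHermitian)
    (hY : ((1 : Matrix C C ℂ) ⊗ₖ Y - ∑ i, H i ⊗ₖ ρ i).PosSemidef)
    (hlt : Y.trace.re < ∑ i, (pairing (H i) (σ i)).re) :
    ∃ (τ : Matrix B B ℂ) (ω : Fin n → Matrix C C ℂ), (∀ i, IsDensityMatrix (ω i)) ∧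
      ((1 : Matrix C C ℂ) ⊗ₖ τ - bipartite q ω ρ).PosSemidef ∧
      τ.trace.re < ∑ i, q i * (pairing (ω i) (σ i)).re := by
  set d : ℝ := (Fintype.card C : ℝ) with hd
  have hd0 : 0 < d := by simp [hd, Fintype.card_pos]
  -- The shift `c i` is chosen to give `H i + c i • 1` trace `K * q i`; `K` is large enough that `c
  -- i ≥ ‖H i‖`, which makes it positive.
  set K : ℝ := 1 + ∑ i, |(d * ‖H i‖ + (H i).trace.re) / q i| with hK
  have hK0 : 0 < K := by positivity
  set c : Fin n → ℝ := fun i => (K * q i - (H i).trace.re) / d with hc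
  have hcH : ∀ i, ‖H i‖ ≤ c i := by
    intro i
    have h1 : (d * ‖H i‖ + (H i).trace.re) / q i ≤ K := by
      refine (le_abs_self _).trans (le_trans ?_ (le_add_of_nonneg_left zero_le_one))
      exact Finset.single_le_sum (f := fun i => |(d * ‖H i‖ + (H i).trace.re) / q i|)
        (fun _ _ => abs_nonneg _) (Finset.mem_univ i)
    rw [div_le_iff₀ (hq i)] at h1
    rw [hc, le_div_iff₀ hd0]
    linarith
  have hpos : ∀ i, (H i + (c i : ℂ) • 1).PosSemidef := by
    intro i
    have h1 : -H i ≤ algebraMap ℝ (Matrix C C ℂ) ‖-H i‖ :=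
      IsSelfAdjoint.le_algebraMap_norm_self (IsSelfAdjoint.neg (hH i))
    have h2 : algebraMap ℝ (Matrix C C ℂ) ‖-H i‖ ≤ algebraMap ℝ (Matrix C C ℂ) (c i) := by
      rw [norm_neg]
      exact algebraMap_mono _ (hcH i)
    have h3 := Matrix.le_iff.1 (h1.trans h2)
    rw [sub_neg_eq_add, add_comm, Algebra.algebraMap_eq_smul_one] at h3
    have h4 : c i • (1 : Matrix C C ℂ) = (c i : ℂ) • 1 := (Complex.coe_smul _ _).symm
    rwa [h4] at h3
  have htrH : ∀ i, (H i).trace = ((H i).trace.re : ℂ) := by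
    intro i
    apply Complex.ext
    · simp
    · have : star (H i).trace = (H i).trace := by rw [← trace_conjTranspose, (hH i).eq]
      simpa using Complex.conj_eq_iff_im.1 this
  have htr : ∀ i, (H i + (c i : ℂ) • (1 : Matrix C C ℂ)).trace = (K * q i : ℝ) := by
    intro i
    rw [trace_add, trace_smul, trace_one, htrH]
    simp only [smul_eq_mul]
    rw [← Complex.ofReal_natCast, ← hd, ← Complex.ofReal_mul, ← Complex.ofReal_add]
    congr 1
    simp only [hc]
    field_simp
    ring
  have hKq : ∀ i, 0 < K * q i := fun i => mul_pos hK0 (hq i)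
  -- Normalizing by `K * q i` cancels the weight `q i`. Adding `∑ c i • ρ i` to `Y` absorbs the
  -- shifts, and both sides of the strict inequality grow by `∑ c i` before scaling.
  refine ⟨((K⁻¹ : ℝ) : ℂ) • (Y + ∑ i, (c i : ℂ) • ρ i),
    fun i => (((K * q i)⁻¹ : ℝ) : ℂ) • (H i + (c i : ℂ) • 1), fun i => ⟨?_, ?_⟩, ?_, ?_⟩
  · exact (hpos i).smul (Complex.zero_le_real.2 (inv_nonneg.2 (hKq i).le))
  · rw [trace_smul, htr, smul_eq_mul, ← Complex.ofReal_mul, inv_mul_cancel₀ (hKq i).ne',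
      Complex.ofReal_one]
  · have : (1 : Matrix C C ℂ) ⊗ₖ (((K⁻¹ : ℝ) : ℂ) • (Y + ∑ i, (c i : ℂ) • ρ i)) -
        bipartite q (fun i => (((K * q i)⁻¹ : ℝ) : ℂ) • (H i + (c i : ℂ) • 1)) ρ =
        ((K⁻¹ : ℝ) : ℂ) • ((1 : Matrix C C ℂ) ⊗ₖ Y - ∑ i, H i ⊗ₖ ρ i) := by
      ext p r
      simp only [bipartite, Matrix.sub_apply, Matrix.smul_apply, kroneckerMap_apply, Matrix.sum_apply,
        Matrix.add_apply,
        smul_eq_mul, mul_add, add_mul, mul_sub, Finset.mul_sum, Finset.sum_add_distrib]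
      rw [add_sub_add_comm]
      have hcancel : ∀ i, (q i : ℂ) * (((K * q i)⁻¹ : ℝ) : ℂ) = ((K⁻¹ : ℝ) : ℂ) := by
        intro i
        rw [← Complex.ofReal_mul, mul_inv, mul_comm, mul_assoc, inv_mul_cancel₀ (hq i).ne',
          mul_one]
      have e1 : ∀ i, (q i : ℂ) * ((((K * q i)⁻¹ : ℝ) : ℂ) * H i p.1 r.1 * ρ i p.2 r.2) =
          ((K⁻¹ : ℝ) : ℂ) * (H i p.1 r.1 * ρ i p.2 r.2) := by
        intro i; rw [← hcancel i]; ring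
      have e2 : ∀ i, (q i : ℂ) * ((((K * q i)⁻¹ : ℝ) : ℂ) *
          ((c i : ℂ) * (1 : Matrix C C ℂ) p.1 r.1) * ρ i p.2 r.2) =
          (1 : Matrix C C ℂ) p.1 r.1 * (((K⁻¹ : ℝ) : ℂ) * ((c i : ℂ) * ρ i p.2 r.2)) := by
        intro i; rw [← hcancel i]; ring
      simp only [e1, e2]
      ring
    rw [this]
    exact hY.smul (Complex.zero_le_real.2 (inv_nonneg.2 hK0.le))
  · have e1 : ∀ i, q i * (pairing ((((K * q i)⁻¹ : ℝ) : ℂ) • (H i + (c i : ℂ) • 1)) (σ i)).re =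
        K⁻¹ * ((pairing (H i) (σ i)).re + c i) := by
      intro i
      rw [pairing_smul_left, pairing_add_left, pairing_smul_left, pairing_one_left, (hσ i).2,
        Complex.re_ofReal_mul, mul_inv]
      have := (hq i).ne'
      simp only [mul_one, Complex.add_re, Complex.ofReal_re]
      field_simp
    simp only [e1, ← Finset.mul_sum, Finset.sum_add_distrib, trace_smul, trace_add, trace_sum,
      (hρ _).2, smul_eq_mul, mul_one, Complex.re_ofReal_mul, Complex.add_re, Complex.re_sum,
      Complex.ofReal_re]
    exact mul_lt_mul_of_pos_left (by linarith) (inv_pos.2 hK0)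

theorem exists_cptp_of_condMinEntropy_le {n : ℕ} {A B C : Type*} [Fintype A] [DecidableEq A]
    [Fintype B] [DecidableEq B] [Fintype C] [DecidableEq C] [Nonempty C] (e : A ≃ C)
    {q : Fin n → ℝ} (hq : ∀ i, 0 < q i) (hq1 : ∑ i, q i = 1)
    {ρ : Fin n → Matrix B B ℂ} (hρ : ∀ i, IsDensityMatrix (ρ i))
    {σ : Fin n → Matrix C C ℂ} (hσ : ∀ i, IsDensityMatrix (σ i))
    (h : ∀ ω : Fin n → Matrix A A ℂ, (∀ i, IsDensityMatrix (ω i)) →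
      condMinEntropy (bipartite q ω ρ) ≤ condMinEntropy (bipartite q ω σ)) :
    ∃ E : Matrix B B ℂ →ₗ[ℂ] Matrix C C ℂ, IsCPTP E ∧ ∀ i, E (ρ i) = σ i := by
  obtain hE | ⟨Y, H, hH, hY, hlt⟩ := exists_choi_or_witness ρ (fun i => (hρ i).1.isHermitian) σ
    (fun i => (hσ i).1.isHermitian)
  · exact hE
  exfalso
  obtain ⟨τ, ω, hω, hτ, hlt⟩ := exists_density_witness hq hρ hσ hH hY hlt
  have hω' : ∀ i, IsDensityMatrix ((ω i).submatrix e e) := fun i =>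
    ⟨(hω i).1.submatrix e, by
      rw [← (hω i).2]
      exact e.sum_comp fun c => ω i c c⟩
  have hle := (condMinEntropy_le_iff (isDensityMatrix_bipartite hq hq1 hω' hρ)
    (isDensityMatrix_bipartite hq hq1 hω' hσ)).1 (h _ hω')
  have hmem : τ.trace.re ∈ dominatingTraces (bipartite q (fun i => (ω i).submatrix e e) ρ) := by
    refine ⟨τ, ?_, ?_, rfl⟩
    -- Positivity of `τ` follows from `1 ⊗ τ ≥ Ω ≥ 0` by restricting to one diagonal block.
    · have h1 := hτ.add (isDensityMatrix_bipartite hq hq1 hω hρ).1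
      rw [sub_add_cancel] at h1
      let c : C := Classical.arbitrary C
      have h2 := h1.submatrix fun b : B => (c, b)
      have h3 : ((1 : Matrix C C ℂ) ⊗ₖ τ).submatrix (fun b : B => (c, b)) (fun b : B => (c, b)) =
          τ := by
        ext b b'
        simp
      rw [h3] at h2
      exact nonneg_iff_posSemidef.2 h2
    · rw [Matrix.le_iff]
      have h1 := hτ.submatrix (Prod.map e id)
      have h2 : ((1 : Matrix C C ℂ) ⊗ₖ τ - bipartite q ω ρ).submatrix (Prod.map e id)
          (Prod.map e id) =
          (1 : Matrix A A ℂ) ⊗ₖ τ - bipartite q (fun i => (ω i).submatrix e e) ρ := by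
        ext p r
        simp [bipartite, Matrix.sum_apply, Matrix.one_apply]
      rwa [h2] at h1
  have h1 := csInf_le (bddBelow_dominatingTraces _) hmem
  have h2 := le_csInf (dominatingTraces_nonempty (isDensityMatrix_bipartite hq hq1 hω' hσ).1)
    fun t ht => pairing_le_of_mem_dominatingTraces e q ω σ ht
  linarith

end QMaj

theorem corollary1 {n : ℕ} {A B C : Type*} [Fintype A] [DecidableEq A]
    [Fintype B] [DecidableEq B] [Fintype C] [DecidableEq C]
    (hAC : Fintype.card A = Fintype.card C)
    (q : Fin n → ℝ) (hq : ∀ i, 0 < q i) (hq1 : ∑ i, q i = 1)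
    (ρ : Fin n → Matrix B B ℂ) (hρ : ∀ i, QMaj.IsDensityMatrix (ρ i))
    (σ : Fin n → Matrix C C ℂ) (hσ : ∀ i, QMaj.IsDensityMatrix (σ i)) :
    (∃ E : Matrix B B ℂ →ₗ[ℂ] Matrix C C ℂ, QMaj.IsCPTP E ∧ ∀ i, E (ρ i) = σ i) ↔
      ∀ ω : Fin n → Matrix A A ℂ, (∀ i, QMaj.IsDensityMatrix (ω i)) →
        QMaj.condMinEntropy (QMaj.marginalAB (QMaj.tripartite q ω ρ σ)) ≤
          QMaj.condMinEntropy (QMaj.marginalAC (QMaj.tripartite q ω ρ σ)) := by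
  simp only [QMaj.marginalAB_tripartite q _ ρ fun i => (hσ i).2,
    QMaj.marginalAC_tripartite q _ σ fun i => (hρ i).2]
  constructor
  · rintro ⟨E, hE, hEρ⟩ ω hω
    have hAB := QMaj.isDensityMatrix_bipartite hq hq1 hω hρ
    have hAC := QMaj.isDensityMatrix_bipartite hq hq1 hω hσ
    exact (QMaj.condMinEntropy_le_iff hAB hAC).2
      (csInf_le_csInf (QMaj.bddBelow_dominatingTraces _) (QMaj.dominatingTraces_nonempty hAB.1)
        (QMaj.dominatingTraces_subset q ω hE hEρ))
  · intro h
    -- If `C` were empty, no `σ i` could have trace one, forcing `n = 0` and contradicting `∑ q i =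
    -- 1`.
    have hC : Nonempty C := by
      by_contra hC
      rw [not_nonempty_iff] at hC
      have h0 : ∀ i : Fin n, False := fun i => by simpa [Matrix.trace] using (hσ i).2
      rw [Finset.sum_eq_zero fun i _ => (h0 i).elim] at hq1
      exact zero_ne_one hq1
    exact QMaj.exists_cptp_of_condMinEntropy_le (Fintype.equivOfCardEq hAC) hq hq1 hρ hσ h
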